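/- **Theorem (Correlations for Lipschitz functionals of the Fleming-Viot particle system).** Let $F^*$ be a countable set, let $(Q_{i,j})_{i,j\in F^*}$ be transition rates ($Q_{i,j}\ge 0$ for $i\ne j$) and let $p_0:F^*\to[0,\infty)$ be death rates. Assume $$(A)\qquad \mathbf{Q_1}=\sup_{i\in F^*}\sum_{j\neq i}Q_{i,j}<\infty,\qquad \mathbf{p}=\sup_{i\in F^*}p_0(i)<\infty .$$ Set $$\lambda=\inf_{i\ne i'}\Big(Q_{i,i'}+Q_{i',i}+\sum_{j\neq i,i'}Q_{i,j}\wedge Q_{i',j}\Big),\qquad \rho=\lambda-\big(\sup p_0-\inf p_0\big)$$ (with $\lambda=0$ if $F^*$ is a single point). Let $N\ge 2$ be an integer and $$E=\Big\{\eta:F^*\to\mathbb N\ \Big|\ \sum_{i\in F^*}\eta(i)=N\Big\},\qquad d_1(\eta,\eta')=\tfrac12\sum_{j\in F^*}|\eta(j)-\eta'(j)| .$$ Let $(\eta_t)_{t\ge0}$ be the Fleming-Viot particle system, i.e. the $E$-valued Markov process with right-continuous paths whose generator is given, for bounded $f:E\to\mathbb R$, by $$\mathcal Lf(\eta)=\sum_{i\in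 F^*}\eta(i)\sum_{j\in F^*}\Big(Q_{i,j}+p_0(i)\frac{\eta(j)}{N-1}\Big)\big(f(T_{i\to j}\eta)-f(\eta)\big),$$ where $T_{i\to j}\eta$ is obtained from $\eta$ by moving one particle from $i$ to $j$; the process is understood as a solution of the martingale problem for $\mathcal L$ on bounded functions. Write $\mathrm{Cov}_\eta$ for the covariance when $\eta_0=\eta$. Let $g,h:E\to\mathbb R$ be $1$-Lipschitz for $d_1$, that is, $|g(\eta)-g(\eta')|\le d_1(\eta,\eta')$ and $|h(\eta)-h(\eta')|\le d_1(\eta,\eta')$ for all $\eta,\eta'\in E$. Then, for all $t\ge 0$ and $\eta\in E$, $$\big|\mathrm{Cov}_\eta\big(g(\eta_t),h(\eta_t)\big)\big|\le\frac{1-e^{-2\rho t}}{2\rho}\Big(N\mathbf{Q_1}+\mathbf p\,\frac{N^2}{N-1}\Big),$$ where $\frac{1-e^{-2\rho t}}{2\rho}$ is read as $t$ when $\rho=0$. In particular, if $\rho>0$, the bound is uniform in time: for all $t\ge0$ and $\eta\in E$, $$\big|\mathrm{Cov}_\eta\big(g(\eta_t),h(\eta_t)\big)\big|\le\frac{1}{2\rho}\Big(N\mathbf{Q_1}+\mathbf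 p\,\frac{N^2}{N-1}\Big).$$ -/

import Mathlib

open MeasureTheory ProbabilityTheory Filter Topology
open scoped NNReal

namespace FlemingViot

/-- Configurations of `N` indistinguishable particles on `S`: `η i` is the number of particles at
site `i`. -/
structure Config (S : Type*) (N : ℕ) where
  /-- the occupation numbers -/
  occ : S →₀ ℕ
  /-- there are `N` particles in total -/
  sum_occ : (occ.sum fun _ n => n) = N

/-- The configuration space carries the discrete topology. -/
instance (S : Type*) (N : ℕ) : TopologicalSpace (Config S N) := ⊥

instance (S : Type*) (N : ℕ) : DiscreteTopology (Config S N) := ⟨rfl⟩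

/-- The configuration space carries the discrete σ-algebra. -/
instance (S : Type*) (N : ℕ) : MeasurableSpace (Config S N) := ⊤

instance (S : Type*) (N : ℕ) : CoeFun (Config S N) (fun _ => S → ℕ) := ⟨fun η => η.occ⟩

theorem sum_move {S : Type*} (η : S →₀ ℕ) (i j : S) (h : η i ≠ 0) :
    ((η - Finsupp.single i 1 + Finsupp.single j 1).sum fun _ n => n) = η.sum fun _ n => n := by
  have hle : Finsupp.single i 1 ≤ η := by
    rw [Finsupp.single_le_iff]; omega
  have key : ∀ a b : S →₀ ℕ,
      ((a + b).sum fun _ n => n) = (a.sum fun _ n => n) + (b.sum fun _ n => n) :=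
    fun a b => by
      classical
      exact Finsupp.sum_add_index' (fun _ => rfl) (fun _ _ _ => rfl)
  have h2 := key (η - Finsupp.single i 1) (Finsupp.single i 1)
  rw [tsub_add_cancel_of_le hle] at h2
  rw [key, h2]
  simp

open Classical in
/-- `η.move i j` is obtained from `η` by moving one particle from `i` to `j`. If there is no
particle at `i` it is `η` itself (such a move always occurs with the weight `η i = 0`). -/
noncomputable def Config.move {S : Type*} {N : ℕ} (η : Config S N) (i j : S) : Config S N :=
  if h : η i ≠ 0 then
    ⟨η.occ - Finsupp.single i 1 + Finsupp.single j 1, (sum_move η.occ i j h).trans η.sum_occ⟩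
  else η

/-- The distance `d₁(η, η') = (1/2) ∑_j |η(j) - η'(j)|` (a finite sum). -/
noncomputable def d₁ {S : Type*} {N : ℕ} (η η' : Config S N) : ℝ :=
  (1 / 2) * ∑' j, |(η j : ℝ) - (η' j : ℝ)|

/-- The generator of the Fleming-Viot particle system. The outer sum runs over the finitely many
occupied sites `i`. -/
noncomputable def generator {S : Type*} (Q : S → S → ℝ) (p₀ : S → ℝ) (N : ℕ)
    (f : Config S N → ℝ) (η : Config S N) : ℝ :=
  ∑ i ∈ η.occ.support, (η i : ℝ) *
    ∑' j, (Q i j + p₀ i * ((η j : ℝ) / ((N : ℝ) - 1))) * (f (η.move i j) - f η)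

/-- The total rate `∑_{j ≠ i} Q i j` at which a particle leaves `i`. -/
noncomputable def exitRate {S : Type*} (Q : S → S → ℝ) (i : S) : ℝ :=
  ∑' j : {j : S // j ≠ i}, Q i j

/-- `Q₁ = sup_i ∑_{j ≠ i} Q i j < ∞` and `p = sup_i p₀ i < ∞`. -/
structure BoundedRates {S : Type*} (Q : S → S → ℝ) (p₀ : S → ℝ) : Prop where
  /-- every row has a finite off-diagonal sum -/
  summable_row : ∀ i, Summable fun j : {j : S // j ≠ i} => Q i j
  /-- these sums are bounded -/
  bddAbove_exitRate : BddAbove (Set.range (exitRate Q))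
  /-- the death rates are bounded -/
  bddAbove_death : BddAbove (Set.range p₀)

/-- `λ = inf_{i ≠ i'} (Q i i' + Q i' i + ∑_{j ≠ i, i'} min (Q i j) (Q i' j))`. -/
noncomputable def ergodicCoeff {S : Type*} (Q : S → S → ℝ) : ℝ :=
  ⨅ q : {q : S × S // q.1 ≠ q.2},
    (Q q.1.1 q.1.2 + Q q.1.2 q.1.1 +
      ∑' j : {j : S // j ≠ q.1.1 ∧ j ≠ q.1.2}, min (Q q.1.1 j) (Q q.1.2 j))

/-- `ρ = λ - (sup p₀ - inf p₀)`. -/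
noncomputable def rho {S : Type*} (Q : S → S → ℝ) (p₀ : S → ℝ) : ℝ :=
  ergodicCoeff Q - ((⨆ i, p₀ i) - (⨅ i, p₀ i))

/-- `(1 - exp (-2ρt)) / (2ρ)`, read as `t` if `ρ = 0`. -/
noncomputable def decayFactor (ρ t : ℝ) : ℝ :=
  open Classical in if ρ = 0 then t else (1 - Real.exp (-2 * ρ * t)) / (2 * ρ)

/-- The constant `N Q₁ + p N² / (N - 1)`. -/
noncomputable def rateBound {S : Type*} (Q : S → S → ℝ) (p₀ : S → ℝ) (N : ℕ) : ℝ :=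
  (N : ℝ) * (⨆ i, exitRate Q i) + (⨆ i, p₀ i) * ((N : ℝ) ^ 2 / ((N : ℝ) - 1))

/-- `X` is a Fleming-Viot particle system started at the configuration `x`: it is adapted, has
right-continuous paths for the discrete topology,
starts at `x`, and solves the martingale problem for the generator, tested against all
bounded functions. -/
structure IsFlemingViot {S Ω : Type*} {mΩ : MeasurableSpace Ω} (Q : S → S → ℝ) (p₀ : S → ℝ)
    (N : ℕ) (x : Config S N) (P : Measure Ω) (ℱ : Filtration ℝ≥0 mΩ)
    (X : ℝ≥0 → Ω → Config S N) : Prop where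
  adapted : ∀ t, Measurable[ℱ t] (X t)
  rightContinuous : ∀ ω t, ContinuousWithinAt (fun s => X s ω) (Set.Ici t) t
  initial : ∀ᵐ ω ∂P, X 0 ω = x
  martingale : ∀ f : Config S N → ℝ, (∃ C, ∀ η, |f η| ≤ C) →
    Martingale
      (fun t ω => f (X t ω) - ∫ s in (0 : ℝ)..(t : ℝ), generator Q p₀ N f (X s.toNNReal ω)) ℱ P

end FlemingViot

/-!
The covariance of `g(X_t)` and `h(X_t)` is computed from the semigroup `P_t = exp (t L)` of the
generator `L`, which is a bounded operator on the bounded functions of the configuration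
(`exists_generatorCLM`). Since `L` is bounded, the martingale problem determines the
one-dimensional distributions: `E f(X_t) = P_t f (x)` (`IsFlemingViot.integral_eq_semigroup`), so
that the covariance is `P_t (g h) (x) - P_t g (x) P_t h (x)`.

Two facts about `L` carry the bound.

* *Contraction.* The systems started at two configurations that differ by the position of one
  particle are coupled: the common particles perform the same jumps, and the two exceptional
  particles jump and die together as often as possible. They meet at rate at least `ergodicCoeff Q`
  by mutation and `⨅ p₀` by death, and a second discrepancy appears, when a common particle dies
  and jumps onto the exceptional one, at rate at most `⨆ p₀`. Hence `1 + ε L` multiplies the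
  Lipschitz constant by at most `1 - ε ρ` for small `ε` (`generator_insert_sub_le`), and by
  uniformization, `exp (t L) = exp (-t / ε) exp ((t / ε) (1 + ε L))`, the semigroup multiplies it
  by at most `exp (-ρ t)` (`displacementLipschitz_semigroup`). Only displacements of a single
  particle have to be considered, so no transport distance is needed.
* *Carré du champ.* `L (f g) - f L g - g L f` is the sum of the products of the increments of `f`
  and `g` over all jumps, weighted by their rates, and the total rate is at most `rateBound`
  (`abs_carreDuChamp_le`).

The function `s ↦ P_s (P_{t-s} g · P_{t-s} h) (x)` interpolates between `P_t g (x) P_t h (x)` and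
`P_t (g h) (x)`. Its derivative is `P_s` of the carré du champ of `P_{t-s} g` and `P_{t-s} h`, hence
at most `exp (-2 ρ (t - s)) * rateBound`, and integrating over `[0, t]` gives the claim
(`abs_semigroup_mul_sub_le`).
-/

namespace FlemingViot

open scoped BoundedContinuousFunction

/-! ### Sums over particles and adding a particle -/

variable {S : Type*} {N n : ℕ}

theorem Config.ext_apply {η η' : Config S N} (h : ∀ k, η k = η' k) : η = η' := by
  cases η; cases η'
  congr
  exact Finsupp.ext h

/-- The configuration obtained from `ξ` by adding one particle at `i`. -/
noncomputable def Config.insert (ξ : Config S n) (i : S) : Config S (n + 1) where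
  occ := ξ.occ + Finsupp.single i 1
  sum_occ := by
    classical
    rw [Finsupp.sum_add_index' (fun _ => rfl) (fun _ _ _ => rfl), ξ.sum_occ]
    simp

open Classical in
theorem Config.insert_apply (ξ : Config S n) (i k : S) :
    ξ.insert i k = ξ k + if i = k then 1 else 0 := by
  simp [Config.insert, Finsupp.single_apply]

open Classical in
theorem Config.move_apply (η : Config S N) {i : S} (hi : η i ≠ 0) (j k : S) :
    η.move i j k = η k - (if i = k then 1 else 0) + if j = k then 1 else 0 := by
  rw [Config.move, dif_pos hi]
  simp [Finsupp.single_apply]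

theorem Config.insert_move_same (ξ : Config S n) (i j : S) :
    (ξ.insert i).move i j = ξ.insert j := by
  classical
  apply Config.ext_apply
  intro k
  rw [Config.move_apply _ (by simp [Config.insert_apply]), Config.insert_apply,
    Config.insert_apply]
  omega

theorem Config.insert_move (ξ : Config S n) {k : S} (hk : ξ k ≠ 0) (i j : S) :
    (ξ.insert i).move k j = (ξ.move k j).insert i := by
  classical
  apply Config.ext_apply
  intro l
  rw [Config.move_apply _ (by rw [Config.insert_apply]; omega), Config.insert_apply,
    Config.insert_apply, Config.move_apply _ hk]
  by_cases h : k = l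
  · subst h
    simp only [if_true]
    omega
  · simp only [h, if_false]
    omega

theorem Config.insert_comm (ξ : Config S n) (i j : S) :
    (ξ.insert i).insert j = (ξ.insert j).insert i := by
  classical
  apply Config.ext_apply
  intro l
  simp only [Config.insert_apply]
  omega

theorem Config.exists_eq_insert (η : Config S (n + 1)) {k : S} (hk : η k ≠ 0) :
    ∃ ξ : Config S n, η = ξ.insert k := by
  classical
  have hle : Finsupp.single k 1 ≤ η.occ := by
    rw [Finsupp.single_le_iff]; omega
  have h0 : η.occ - Finsupp.single k 1 + Finsupp.single k 1 = η.occ := tsub_add_cancel_of_le hle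
  refine ⟨⟨η.occ - Finsupp.single k 1, ?_⟩, ?_⟩
  · have h := η.sum_occ
    rw [← h0, Finsupp.sum_add_index' (fun _ => rfl) (fun _ _ _ => rfl)] at h
    simpa using h
  · apply Config.ext_apply
    intro l
    exact (DFunLike.congr_fun h0 l).symm

/-- A move of a particle from `k` to `k` does nothing. -/
theorem Config.move_self (η : Config S N) (k : S) : η.move k k = η := by
  classical
  by_cases hk : η k = 0
  · simp [Config.move, hk]
  · apply Config.ext_apply
    intro l
    rw [Config.move_apply _ hk]
    by_cases h : k = l
    · subst h
      simp only [if_true]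
      omega
    · simp [h]

/-- The sum of `H` over the particles of `η`, counted with multiplicity. -/
noncomputable def Config.particleSum (η : Config S N) (H : S → ℝ) : ℝ :=
  ∑ k ∈ η.occ.support, (η k : ℝ) * H k

theorem Config.particleSum_insert (ξ : Config S n) (i : S) (H : S → ℝ) :
    (ξ.insert i).particleSum H = ξ.particleSum H + H i := by
  classical
  have h := Finsupp.sum_add_index' (f := ξ.occ) (g := Finsupp.single i 1)
    (h := fun k (m : ℕ) => (m : ℝ) * H k) (by simp) (by intros; push_cast; ring)
  rw [Finsupp.sum_single_index (by simp)] at h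
  simpa [Finsupp.sum, Config.particleSum, Config.insert] using h

theorem Config.particleSum_const (η : Config S N) (c : ℝ) :
    η.particleSum (fun _ => c) = N * c := by
  have h : ((η.occ.sum fun _ m => m : ℕ) : ℝ) = N := by rw [η.sum_occ]
  rw [Config.particleSum, ← Finset.sum_mul, ← h, Finsupp.sum]
  push_cast
  rfl

theorem Config.particleSum_congr (η : Config S N) {H K : S → ℝ}
    (h : ∀ k, η k ≠ 0 → H k = K k) : η.particleSum H = η.particleSum K :=
  Finset.sum_congr rfl fun k hk => by rw [h k (by simpa using hk)]

theorem Config.particleSum_mono (η : Config S N) {H K : S → ℝ}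
    (h : ∀ k, η k ≠ 0 → H k ≤ K k) : η.particleSum H ≤ η.particleSum K :=
  Finset.sum_le_sum fun k hk =>
    mul_le_mul_of_nonneg_left (h k (by simpa using hk)) (Nat.cast_nonneg _)

theorem Config.particleSum_le (η : Config S N) {H : S → ℝ} {c : ℝ}
    (h : ∀ k, η k ≠ 0 → H k ≤ c) : η.particleSum H ≤ N * c :=
  (η.particleSum_mono h).trans (η.particleSum_const c).le

theorem Config.abs_particleSum_le (η : Config S N) {H : S → ℝ} {c : ℝ}
    (h : ∀ k, η k ≠ 0 → |H k| ≤ c) : |η.particleSum H| ≤ N * c := by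
  refine le_trans (Finset.abs_sum_le_sum_abs _ _) ?_
  simp only [abs_mul, Nat.abs_cast]
  exact η.particleSum_le h

theorem Config.particleSum_add (η : Config S N) (H K : S → ℝ) :
    η.particleSum (fun k => H k + K k) = η.particleSum H + η.particleSum K := by
  simp [Config.particleSum, mul_add, Finset.sum_add_distrib]

theorem Config.particleSum_const_mul (η : Config S N) (a : ℝ) (H : S → ℝ) :
    η.particleSum (fun k => a * H k) = a * η.particleSum H := by
  rw [Config.particleSum, Config.particleSum, Finset.mul_sum]
  exact Finset.sum_congr rfl fun k _ => by ring

theorem Config.particleSum_sub (η : Config S N) (H K : S → ℝ) :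
    η.particleSum (fun k => H k - K k) = η.particleSum H - η.particleSum K := by
  simp [Config.particleSum, mul_sub, Finset.sum_sub_distrib]

/-! ### Bounds on the rates -/

open Classical in
/-- The rates `Q` with the (irrelevant) diagonal replaced by zero. -/
noncomputable def offDiag (Q : S → S → ℝ) (i j : S) : ℝ := if j = i then 0 else Q i j

variable {Q : S → S → ℝ} {p₀ : S → ℝ}

theorem offDiag_self (Q : S → S → ℝ) (i : S) : offDiag Q i i = 0 := by simp [offDiag]

theorem offDiag_eq_indicator (Q : S → S → ℝ) (i : S) :
    offDiag Q i = Set.indicator {j | j ≠ i} (Q i) := by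
  classical
  ext j
  by_cases h : j = i <;> simp [offDiag, h]

theorem offDiag_nonneg (hQ : ∀ i j, i ≠ j → 0 ≤ Q i j) (i j : S) : 0 ≤ offDiag Q i j := by
  rw [offDiag]
  split_ifs with h
  · exact le_rfl
  · exact hQ i j (Ne.symm h)

theorem BoundedRates.summable_offDiag (hA : BoundedRates Q p₀) (i : S) :
    Summable (offDiag Q i) := by
  rw [offDiag_eq_indicator]
  exact summable_subtype_iff_indicator.1 (hA.summable_row i)

theorem tsum_offDiag (Q : S → S → ℝ) (i : S) : ∑' j, offDiag Q i j = exitRate Q i := by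
  rw [offDiag_eq_indicator, exitRate]
  exact (tsum_subtype {j | j ≠ i} (Q i)).symm

theorem BoundedRates.tsum_offDiag_le (hA : BoundedRates Q p₀) (i : S) :
    ∑' j, offDiag Q i j ≤ ⨆ i, exitRate Q i := by
  rw [tsum_offDiag]
  exact le_ciSup hA.bddAbove_exitRate i

theorem ergodicCoeff_le (hQ : ∀ i j, i ≠ j → 0 ≤ Q i j) {i i' : S} (hi : i ≠ i') :
    ergodicCoeff Q ≤ offDiag Q i i' + offDiag Q i' i +
      ∑' j, min (offDiag Q i j) (offDiag Q i' j) := by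
  have hbdd : BddBelow (Set.range fun q : {q : S × S // q.1 ≠ q.2} =>
      Q q.1.1 q.1.2 + Q q.1.2 q.1.1 +
        ∑' j : {j : S // j ≠ q.1.1 ∧ j ≠ q.1.2}, min (Q q.1.1 j) (Q q.1.2 j)) := by
    refine ⟨0, ?_⟩
    rintro _ ⟨⟨⟨a, b⟩, hab⟩, rfl⟩
    have h1 := hQ a b hab
    have h2 := hQ b a (Ne.symm hab)
    have h3 : 0 ≤ ∑' j : {j : S // j ≠ a ∧ j ≠ b}, min (Q a j) (Q b j) :=
      tsum_nonneg fun j => le_min (hQ _ _ j.2.1.symm) (hQ _ _ j.2.2.symm)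
    simp only
    linarith
  refine (ciInf_le hbdd ⟨(i, i'), hi⟩).trans_eq ?_
  have h1 : offDiag Q i i' = Q i i' := by simp [offDiag, hi.symm]
  have h2 : offDiag Q i' i = Q i' i := by simp [offDiag, hi]
  rw [h1, h2]
  congr 1
  refine (tsum_subtype {j | j ≠ i ∧ j ≠ i'} fun j => min (Q i j) (Q i' j)).trans ?_
  refine tsum_congr fun j => ?_
  classical
  by_cases h3 : j = i
  · subst h3
    simp [offDiag_self, offDiag_nonneg hQ]
  · by_cases h4 : j = i'
    · subst h4
      simp [offDiag_self, offDiag_nonneg hQ]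
    · simp [offDiag, h3, h4]

/-! ### The generator as a jump functional -/

/-- The sum of `D k j` over all jumps `k → j` out of `η`, each weighted by its rate. The jumps with
`j = k`, which do not change `η`, are left out of the mutations but not of the deaths. -/
noncomputable def jumpSum (Q : S → S → ℝ) (p₀ : S → ℝ) (η : Config S N) (D : S → S → ℝ) : ℝ :=
  η.particleSum fun k => ∑' j, offDiag Q k j * D k j + p₀ k / ((N : ℝ) - 1) * η.particleSum (D k)

theorem BoundedRates.summable_mul (hA : BoundedRates Q p₀) (hQ : ∀ i j, i ≠ j → 0 ≤ Q i j)
    (k : S) {D : S → ℝ} {c : ℝ} (hD : ∀ j, |D j| ≤ c) :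
    Summable fun j => offDiag Q k j * D j := by
  refine Summable.of_norm_bounded (g := fun j => offDiag Q k j * c)
    ((hA.summable_offDiag k).mul_right c) fun j => ?_
  rw [Real.norm_eq_abs, abs_mul, abs_of_nonneg (offDiag_nonneg hQ k j)]
  exact mul_le_mul_of_nonneg_left (hD j) (offDiag_nonneg hQ k j)

theorem generator_eq_jumpSum (hA : BoundedRates Q p₀) (hQ : ∀ i j, i ≠ j → 0 ≤ Q i j)
    {f : Config S N → ℝ} {C : ℝ} (hf : ∀ η, |f η| ≤ C) (η : Config S N) :
    generator Q p₀ N f η = jumpSum Q p₀ η fun k j => f (η.move k j) - f η := by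
  refine Finset.sum_congr rfl fun k _ => ?_
  congr 1
  have hD : ∀ j, |f (η.move k j) - f η| ≤ C + C := fun j =>
    (abs_sub _ _).trans (add_le_add (hf _) (hf _))
  have hfin : ∀ j ∉ η.occ.support, (η j : ℝ) * (f (η.move k j) - f η) = 0 := by
    intro j hj
    simp [Finsupp.notMem_support_iff.1 hj]
  have h1 : ∀ j, (Q k j + p₀ k * ((η j : ℝ) / ((N : ℝ) - 1))) * (f (η.move k j) - f η) =
      offDiag Q k j * (f (η.move k j) - f η) +
        p₀ k / ((N : ℝ) - 1) * ((η j : ℝ) * (f (η.move k j) - f η)) := by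
    intro j
    by_cases h : j = k
    · subst h
      simp [Config.move_self]
    · simp only [offDiag, if_neg h]
      ring
  simp only [h1]
  rw [(hA.summable_mul hQ k hD).tsum_add
    ((summable_of_ne_finset_zero (s := η.occ.support) hfin).mul_left _), tsum_mul_left,
    tsum_eq_sum hfin]
  rfl

theorem abs_jumpSum_le (hA : BoundedRates Q p₀) (hQ : ∀ i j, i ≠ j → 0 ≤ Q i j)
    (hp₀ : ∀ i, 0 ≤ p₀ i) (hN : 1 ≤ N) (η : Config S N) {D : S → S → ℝ} {c : ℝ}
    (hD : ∀ k j, |D k j| ≤ c) : |jumpSum Q p₀ η D| ≤ rateBound Q p₀ N * c := by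
  have hN' : (0 : ℝ) ≤ (N : ℝ) - 1 := by
    have : (1 : ℝ) ≤ N := by exact_mod_cast hN
    linarith
  have h : |jumpSum Q p₀ η D| ≤ N * ((⨆ i, exitRate Q i) * c +
      (⨆ i, p₀ i) / ((N : ℝ) - 1) * (N * c)) := by
    refine η.abs_particleSum_le fun k _ => (abs_add_le _ _).trans (add_le_add ?_ ?_)
    · have hc : 0 ≤ c := (abs_nonneg _).trans (hD k k)
      have hs := hA.summable_mul hQ k (hD k)
      calc |∑' j, offDiag Q k j * D k j| ≤ ∑' j, |offDiag Q k j * D k j| := by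
            simpa only [Real.norm_eq_abs] using norm_tsum_le_tsum_norm hs.norm
        _ ≤ ∑' j, offDiag Q k j * c := by
            refine hs.abs.tsum_le_tsum (fun j => ?_) ((hA.summable_offDiag k).mul_right c)
            rw [abs_mul, abs_of_nonneg (offDiag_nonneg hQ k j)]
            exact mul_le_mul_of_nonneg_left (hD k j) (offDiag_nonneg hQ k j)
        _ = (∑' j, offDiag Q k j) * c := tsum_mul_right
        _ ≤ _ := mul_le_mul_of_nonneg_right (hA.tsum_offDiag_le k) hc
    · rw [abs_mul, abs_of_nonneg (div_nonneg (hp₀ k) hN')]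
      exact mul_le_mul (div_le_div_of_nonneg_right (le_ciSup hA.bddAbove_death k) hN')
        (η.abs_particleSum_le fun j _ => hD k j) (abs_nonneg _)
        (div_nonneg (Real.iSup_nonneg hp₀) hN')
  refine h.trans_eq ?_
  rw [rateBound]
  ring

theorem jumpSum_add (hA : BoundedRates Q p₀) (hQ : ∀ i j, i ≠ j → 0 ≤ Q i j)
    (η : Config S N) {D D' : S → S → ℝ} {c c' : ℝ}
    (hD : ∀ k j, |D k j| ≤ c) (hD' : ∀ k j, |D' k j| ≤ c') :
    jumpSum Q p₀ η (fun k j => D k j + D' k j) = jumpSum Q p₀ η D + jumpSum Q p₀ η D' := by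
  unfold jumpSum
  rw [← Config.particleSum_add]
  refine η.particleSum_congr fun k _ => ?_
  simp only [Config.particleSum_add, mul_add]
  rw [(hA.summable_mul hQ k (hD k)).tsum_add (hA.summable_mul hQ k (hD' k))]
  ring

theorem jumpSum_const_mul (η : Config S N) (a : ℝ) (D : S → S → ℝ) :
    jumpSum Q p₀ η (fun k j => a * D k j) = a * jumpSum Q p₀ η D := by
  unfold jumpSum
  rw [← Config.particleSum_const_mul]
  refine η.particleSum_congr fun k _ => ?_
  simp only [Config.particleSum_const_mul, mul_left_comm _ a, tsum_mul_left]
  ring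

theorem rateBound_nonneg (hQ : ∀ i j, i ≠ j → 0 ≤ Q i j)
    (hp₀ : ∀ i, 0 ≤ p₀ i) (hN : 1 ≤ N) : 0 ≤ rateBound Q p₀ N := by
  have hN' : (0 : ℝ) ≤ (N : ℝ) - 1 := by
    have : (1 : ℝ) ≤ N := by exact_mod_cast hN
    linarith
  have h1 : 0 ≤ ⨆ i, exitRate Q i :=
    Real.iSup_nonneg fun i => tsum_nonneg fun j => hQ _ _ j.2.symm
  have h2 : 0 ≤ ⨆ i, p₀ i := Real.iSup_nonneg hp₀
  rw [rateBound]
  positivity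

/-! ### The coupling estimate -/

/-- `f` changes by at most `c` when one particle is displaced. This is the Lipschitz condition for
`d₁`, since `d₁` is the graph distance for displacements of one particle. -/
def DisplacementLipschitz (f : Config S (n + 1) → ℝ) (c : ℝ) : Prop :=
  ∀ (ξ : Config S n) (i j : S), f (ξ.insert i) - f (ξ.insert j) ≤ c

theorem DisplacementLipschitz.abs_move_sub_le {f : Config S (n + 1) → ℝ} {c : ℝ}
    (hf : DisplacementLipschitz f c) (η : Config S (n + 1)) (k j : S) :
    |f (η.move k j) - f η| ≤ c := by
  by_cases hk : η k = 0
  · have hc : 0 ≤ c := by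
      have h : η.occ ≠ 0 := by
        intro h0
        have := η.sum_occ
        simp [h0] at this
      obtain ⟨l, hl⟩ := Finsupp.ne_iff.1 h
      obtain ⟨ξ, -⟩ := η.exists_eq_insert hl
      simpa using hf ξ k k
    simp [Config.move, hk, hc]
  · obtain ⟨ξ, rfl⟩ := η.exists_eq_insert hk
    rw [Config.insert_move_same, abs_le]
    constructor <;> linarith [hf ξ j k, hf ξ k j]

theorem displacementLipschitz_of_d₁ {f : Config S (n + 1) → ℝ}
    (hf : ∀ η η', |f η - f η'| ≤ d₁ η η') : DisplacementLipschitz f 1 := by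
  classical
  intro ξ i j
  refine (le_abs_self _).trans ((hf _ _).trans ?_)
  have h : ∀ k, |((ξ.insert i k : ℕ) : ℝ) - (ξ.insert j k : ℕ)| ≤
      (if k = i then 1 else 0) + if k = j then 1 else 0 := by
    intro k
    simp only [Config.insert_apply]
    push_cast
    rw [add_sub_add_left_eq_sub]
    simp only [@eq_comm S i k, @eq_comm S j k]
    split_ifs <;> simp
  have hs : ∀ l : S, HasSum (fun k => if k = l then (1 : ℝ) else 0) 1 := fun l =>
    hasSum_ite_eq l 1
  have hs2 := (hs i).add (hs j)
  have hle : ∑' k, |((ξ.insert i k : ℕ) : ℝ) - (ξ.insert j k : ℕ)| ≤ 1 + 1 := by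
    rw [← hs2.tsum_eq]
    exact (Summable.of_nonneg_of_le (fun _ => abs_nonneg _) h hs2.summable).tsum_le_tsum h
      hs2.summable
  rw [d₁]
  linarith

/-- The contribution of the mutations of the extra particle: the particles at `i` and `i'` jump
together at rate `min (a j) (b j)`, and meet as well when one jumps onto the other. -/
theorem mutation_extra_le {a b : S → ℝ} (ha : ∀ j, 0 ≤ a j) (hb : ∀ j, 0 ≤ b j)
    (hsa : Summable a) (hsb : Summable b) {A : S → ℝ} {c C : ℝ} (hAC : ∀ j, |A j| ≤ C)
    (hA : ∀ j l, A j - A l ≤ c) {i i' : S} (hai : a i = 0) (hbi : b i' = 0) :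
    ∑' j, a j * (A j - A i) - ∑' j, b j * (A j - A i') ≤
      (∑' j, a j + ∑' j, b j) * (c - (A i - A i')) -
        c * (a i' + b i + ∑' j, min (a j) (b j)) := by
  classical
  have hsm : Summable fun j => min (a j) (b j) :=
    Summable.of_nonneg_of_le (fun j => le_min (ha j) (hb j)) (fun j => min_le_left _ _) hsa
  have hbound : ∀ (w : S → ℝ), (∀ j, 0 ≤ w j) → Summable w → ∀ l,
      Summable fun j => w j * (A j - A l) := by
    intro w hw hsw l
    refine Summable.of_norm_bounded (g := fun j => w j * (C + C)) (hsw.mul_right _) fun j => ?_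
    rw [Real.norm_eq_abs, abs_mul, abs_of_nonneg (hw j)]
    exact mul_le_mul_of_nonneg_left ((abs_sub _ _).trans (add_le_add (hAC _) (hAC _))) (hw j)
  -- With `θ = c - (A i - A i')`, the summand at `j` is at most
  -- `(a j + b j) * θ - c * min (a j) (b j)`, less `c * a i'` at `j = i'` and `c * b i` at `j = i`;
  -- the two `ite` sums collect these two terms.
  have hR := (((hsa.hasSum.add hsb.hasSum).mul_right (c - (A i - A i'))).sub
    (((hasSum_ite_eq i' (a i')).add (hasSum_ite_eq i (b i))).add hsm.hasSum |>.mul_left c))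
  rw [← (hbound a ha hsa i).tsum_sub (hbound b hb hsb i'), ← hR.tsum_eq]
  refine ((hbound a ha hsa i).sub (hbound b hb hsb i')).tsum_le_tsum (fun j => ?_) hR.summable
  have h1 := hA i i'
  have h2 := hA j i'
  have h3 := hA i j
  by_cases hji : j = i
  · subst hji
    rw [hai, min_eq_left (hb j)]
    by_cases hji' : j = i'
    · subst hji'
      simp [hai, hbi]
    · simp only [if_true, hji', if_false]
      linarith
  · by_cases hji' : j = i'
    · subst hji'
      rw [hbi, min_eq_right (ha j)]
      simp only [if_true, hji, if_false]
      linarith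
    · simp only [hji, hji', if_false]
      rcases le_total (a j) (b j) with h | h
      · rw [min_eq_left h]
        nlinarith [mul_nonneg (sub_nonneg.2 h) (sub_nonneg.2 h3),
          mul_nonneg (ha j) (sub_nonneg.2 h1)]
      · rw [min_eq_right h]
        nlinarith [mul_nonneg (sub_nonneg.2 h) (sub_nonneg.2 h2),
          mul_nonneg (hb j) (sub_nonneg.2 h1)]

/-- The contribution of the death of the extra particle: the particles at `i` and `i'` die
together at rate `min p p'`. Here `x`, `y`, `z` are the values of `f` with the extra particle at
`i`, at `i'`, and at the site chosen after its death. -/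
theorem death_extra_le {p p' P R c x y z : ℝ} (hp : p ≤ P) (hp' : p' ≤ P)
    (hR : R ≤ p) (hR' : R ≤ p') (hc : 0 ≤ c) (hxy : x - y ≤ c) (hzy : z - y ≤ c)
    (hxz : x - z ≤ c) :
    p * (z - x) - p' * (z - y) ≤ P * (c - (x - y)) - R * c := by
  rcases le_total p p' with h | h
  · nlinarith [mul_nonneg (sub_nonneg.2 h) (sub_nonneg.2 hxz),
      mul_nonneg (sub_nonneg.2 hp') (sub_nonneg.2 hxy), mul_nonneg (sub_nonneg.2 hR) hc]
  · nlinarith [mul_nonneg (sub_nonneg.2 h) (sub_nonneg.2 hzy),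
      mul_nonneg (sub_nonneg.2 hp) (sub_nonneg.2 hxy), mul_nonneg (sub_nonneg.2 hR') hc]

/-- The generator at `ξ.insert i`, split into the jumps of the particles of `ξ` and those of the
extra particle at `i`. -/
theorem generator_insert (hA : BoundedRates Q p₀) (hQ : ∀ i j, i ≠ j → 0 ≤ Q i j)
    {f : Config S (n + 1) → ℝ} {C : ℝ} (hf : ∀ η, |f η| ≤ C) (ξ : Config S n) (i : S) :
    generator Q p₀ (n + 1) f (ξ.insert i) =
      ξ.particleSum (fun k =>
        ∑' j, offDiag Q k j * (f ((ξ.move k j).insert i) - f (ξ.insert i)) +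
          p₀ k / n * (ξ.particleSum (fun l => f ((ξ.move k l).insert i) - f (ξ.insert i)) +
            (f ((ξ.move k i).insert i) - f (ξ.insert i)))) +
      (∑' j, offDiag Q i j * (f (ξ.insert j) - f (ξ.insert i)) +
        p₀ i / n * ξ.particleSum (fun l => f (ξ.insert l) - f (ξ.insert i))) := by
  rw [generator_eq_jumpSum hA hQ hf, jumpSum, Config.particleSum_insert]
  have hn : ((n + 1 : ℕ) : ℝ) - 1 = n := by push_cast; ring
  rw [hn]
  congr 1
  · refine ξ.particleSum_congr fun k hk => ?_
    simp only [Config.insert_move _ hk, Config.particleSum_insert]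
  · simp only [Config.insert_move_same, Config.particleSum_insert, sub_self, add_zero]

/-- A displacement of the extra particle together with the same displacement of the target of a
jump costs two displacements. -/
theorem DisplacementLipschitz.move_insert_sub_le {f : Config S (n + 1) → ℝ} {c : ℝ}
    (hf : DisplacementLipschitz f c) (ξ : Config S n) {k : S} (hk : ξ k ≠ 0) (i i' : S) :
    f ((ξ.move k i).insert i) - f ((ξ.move k i').insert i') ≤ 2 * c := by
  cases n with
  | zero =>
    have h0 : ξ.occ = 0 := by
      ext l
      have h := ξ.sum_occ
      rw [Finsupp.sum, Finset.sum_eq_zero_iff] at h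
      by_contra hl
      exact hl (h l (by simpa using hl))
    simp [h0] at hk
  | succ m =>
    obtain ⟨ζ, rfl⟩ := ξ.exists_eq_insert hk
    rw [Config.insert_move_same, Config.insert_move_same]
    have h1 := hf (ζ.insert i) i i'
    have h2 := hf (ζ.insert i') i i'
    rw [Config.insert_comm ζ i i'] at h1
    linarith

/-- The drift of `f (ξ.insert i) - f (ξ.insert i')` under the coupling of the systems started at
`ξ.insert i` and `ξ.insert i'`: a difference close to its maximal value `c` decreases at rate
`rho`. -/
theorem generator_insert_sub_le (hA : BoundedRates Q p₀) (hQ : ∀ i j, i ≠ j → 0 ≤ Q i j)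
    (hp₀ : ∀ i, 0 ≤ p₀ i) (hn : n ≠ 0) {f : Config S (n + 1) → ℝ} {C c : ℝ}
    (hfC : ∀ η, |f η| ≤ C) (hf : DisplacementLipschitz f c) (ξ : Config S n) {i i' : S}
    (hi : i ≠ i') :
    generator Q p₀ (n + 1) f (ξ.insert i) - generator Q p₀ (n + 1) f (ξ.insert i') ≤
      (n + 2) * ((⨆ i, exitRate Q i) + ⨆ i, p₀ i) *
        (c - (f (ξ.insert i) - f (ξ.insert i'))) - rho Q p₀ * c := by
  rw [generator_insert hA hQ hfC, generator_insert hA hQ hfC]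
  have hn' : (0 : ℝ) < n := by exact_mod_cast Nat.pos_of_ne_zero hn
  have hc : 0 ≤ c := by simpa using hf ξ i i
  set q := ⨆ i, exitRate Q i with hq
  set P := ⨆ i, p₀ i with hP
  set R := ⨅ i, p₀ i with hR
  set θ := c - (f (ξ.insert i) - f (ξ.insert i')) with hθ
  have hθ0 : 0 ≤ θ := sub_nonneg.2 (hf ξ i i')
  have hpP : ∀ k, p₀ k ≤ P := fun k => le_ciSup hA.bddAbove_death k
  have hRp : ∀ k, R ≤ p₀ k := fun k => ciInf_le ⟨0, by rintro _ ⟨j, rfl⟩; exact hp₀ j⟩ k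
  have hdiff : ∀ η η', |f η - f η'| ≤ C + C := fun η η' =>
    (abs_sub _ _).trans (add_le_add (hfC _) (hfC _))
  -- the particles of `ξ` perform the same jumps in both systems
  have hξ : ξ.particleSum (fun k =>
        ∑' j, offDiag Q k j * (f ((ξ.move k j).insert i) - f (ξ.insert i)) +
          p₀ k / n * (ξ.particleSum (fun l => f ((ξ.move k l).insert i) - f (ξ.insert i)) +
            (f ((ξ.move k i).insert i) - f (ξ.insert i)))) -
      ξ.particleSum (fun k =>
        ∑' j, offDiag Q k j * (f ((ξ.move k j).insert i') - f (ξ.insert i')) +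
          p₀ k / n * (ξ.particleSum (fun l => f ((ξ.move k l).insert i') - f (ξ.insert i')) +
            (f ((ξ.move k i').insert i') - f (ξ.insert i')))) ≤
      n * (q * θ + P / n * (n * θ + (c + θ))) := by
    rw [← Config.particleSum_sub]
    refine ξ.particleSum_le fun k hk => ?_
    have h1 : ∑' j, offDiag Q k j * (f ((ξ.move k j).insert i) - f (ξ.insert i)) -
        ∑' j, offDiag Q k j * (f ((ξ.move k j).insert i') - f (ξ.insert i')) ≤ q * θ := by
      have hs1 := hA.summable_mul hQ k fun j => hdiff ((ξ.move k j).insert i) (ξ.insert i)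
      have hs2 := hA.summable_mul hQ k fun j => hdiff ((ξ.move k j).insert i') (ξ.insert i')
      rw [← hs1.tsum_sub hs2]
      refine ((hs1.sub hs2).tsum_le_tsum (fun j => ?_)
        ((hA.summable_offDiag k).mul_right θ)).trans ?_
      · rw [← mul_sub]
        refine mul_le_mul_of_nonneg_left ?_ (offDiag_nonneg hQ k j)
        linarith [hf (ξ.move k j) i i']
      · rw [tsum_mul_right]
        exact mul_le_mul_of_nonneg_right (hA.tsum_offDiag_le k) hθ0
    have h2 : ξ.particleSum (fun l => f ((ξ.move k l).insert i) - f (ξ.insert i)) -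
        ξ.particleSum (fun l => f ((ξ.move k l).insert i') - f (ξ.insert i')) ≤ n * θ := by
      rw [← Config.particleSum_sub]
      refine ξ.particleSum_le fun l _ => ?_
      linarith [hf (ξ.move k l) i i']
    have h3 := hf.move_insert_sub_le ξ hk i i'
    have h4 : p₀ k / n * (ξ.particleSum (fun l => f ((ξ.move k l).insert i) - f (ξ.insert i)) +
            (f ((ξ.move k i).insert i) - f (ξ.insert i))) -
        p₀ k / n * (ξ.particleSum (fun l => f ((ξ.move k l).insert i') - f (ξ.insert i')) +
            (f ((ξ.move k i').insert i') - f (ξ.insert i'))) ≤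
        P / n * (n * θ + (c + θ)) := by
      rw [← mul_sub]
      refine (mul_le_mul_of_nonneg_left ?_ (div_nonneg (hp₀ k) hn'.le)).trans
        (mul_le_mul_of_nonneg_right (div_le_div_of_nonneg_right (hpP k) hn'.le) (by positivity))
      linarith
    linarith
  -- the extra particles mutate and die together as often as their rates allow
  have hmut := mutation_extra_le (offDiag_nonneg hQ i) (offDiag_nonneg hQ i')
    (hA.summable_offDiag i) (hA.summable_offDiag i') (fun j => hfC (ξ.insert j))
    (fun j l => hf ξ j l) (offDiag_self Q i) (offDiag_self Q i')
  rw [← hθ] at hmut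
  have hmut2 := mul_le_mul_of_nonneg_right
    (add_le_add (hA.tsum_offDiag_le i) (hA.tsum_offDiag_le i')) hθ0
  have hmut3 := mul_le_mul_of_nonneg_left (ergodicCoeff_le hQ hi) hc
  have hdeath : p₀ i / n * ξ.particleSum (fun l => f (ξ.insert l) - f (ξ.insert i)) -
      p₀ i' / n * ξ.particleSum (fun l => f (ξ.insert l) - f (ξ.insert i')) ≤
      P * θ - R * c := by
    rw [← Config.particleSum_const_mul, ← Config.particleSum_const_mul,
      ← Config.particleSum_sub]
    have h := ξ.particleSum_le (c := (P * θ - R * c) / n)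
      (H := fun l => p₀ i / n * (f (ξ.insert l) - f (ξ.insert i)) -
        p₀ i' / n * (f (ξ.insert l) - f (ξ.insert i'))) fun l _ => by
        rw [div_mul_eq_mul_div, div_mul_eq_mul_div, ← sub_div]
        exact div_le_div_of_nonneg_right (death_extra_le (hpP i) (hpP i') (hRp i) (hRp i') hc
          (hf ξ i i') (hf ξ l i') (hf ξ i l)) hn'.le
    rwa [mul_div_cancel₀ _ hn'.ne'] at h
  have hsimp : n * (q * θ + P / n * (n * θ + (c + θ))) =
      n * q * θ + n * P * θ + P * (c + θ) := by
    field_simp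
    ring
  rw [hsimp] at hξ
  rw [rho, ← hP, ← hR]
  linarith

/-! ### Semigroups with a bounded generator -/

section Semigroup

variable {E : Type*} [NormedAddCommGroup E] [NormedSpace ℝ E]

/-- The semigroup `exp (t L)` generated by the bounded operator `L`. -/
noncomputable def semigroup (L : E →L[ℝ] E) (t : ℝ) : E →L[ℝ] E := NormedSpace.exp (t • L)

theorem semigroup_zero (L : E →L[ℝ] E) (f : E) : semigroup L 0 f = f := by
  simp [semigroup, NormedSpace.exp_zero]

variable [CompleteSpace E]

theorem hasDerivAt_semigroup (L : E →L[ℝ] E) (f : E) (t : ℝ) :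
    HasDerivAt (fun t => semigroup L t f) (L (semigroup L t f)) t := by
  simpa [semigroup] using (hasDerivAt_exp_smul_const' (𝕂 := ℝ) L t).clm_apply (hasDerivAt_const t f)

theorem HasDerivAt.semigroup_apply (L : E →L[ℝ] E) {v : ℝ → E} {v' : E} {s : ℝ}
    (hv : HasDerivAt v v' s) :
    HasDerivAt (fun s => semigroup L s (v s)) (semigroup L s (L (v s) + v')) s := by
  simpa [semigroup] using (hasDerivAt_exp_smul_const (𝕂 := ℝ) L s).clm_apply hv

/-- The uniformization `exp (t L) = exp (-t / ε) exp ((t / ε) (1 + ε L))`: if a functional decays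
like `r ^ m` along the iterates of `1 + ε L`, then it decays like `exp (-t (1 - r) / ε)` along the
semigroup. -/
theorem apply_semigroup_le_of_step (L : E →L[ℝ] E) (ℓ : E →L[ℝ] ℝ) {f : E} {c ε r : ℝ}
    (hε : 0 < ε) (hpow : ∀ m : ℕ, ℓ ((fun f => f + ε • L f)^[m] f) ≤ c * r ^ m) {t : ℝ}
    (ht : 0 ≤ t) : ℓ (semigroup L t f) ≤ c * Real.exp (-(t * (1 - r) / ε)) := by
  set K : E →L[ℝ] E := 1 + ε • L with hK
  have hiter : ∀ m : ℕ, (K ^ m) f = (fun f => f + ε • L f)^[m] f := by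
    intro m
    induction m with
    | zero => rfl
    | succ m ih =>
      rw [pow_succ', Function.iterate_succ_apply', ← ih]
      rfl
  have hdecomp : t • L = (t / ε) • K + algebraMap ℝ (E →L[ℝ] E) (-(t / ε)) := by
    rw [hK, Algebra.algebraMap_eq_smul_one, smul_add, smul_smul, div_mul_cancel₀ _ hε.ne', neg_smul]
    abel
  let _ : NormedAlgebra ℚ (E →L[ℝ] E) := NormedAlgebra.restrictScalars ℚ ℝ _
  have hexp : semigroup L t = Real.exp (-(t / ε)) • NormedSpace.exp ((t / ε) • K) := by
    rw [semigroup, hdecomp, NormedSpace.exp_add_of_commute (Algebra.commutes _ _).symm,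
      ← NormedSpace.algebraMap_exp_comm, ← Real.exp_eq_exp_ℝ, ← Algebra.commutes,
      ← Algebra.smul_def]
  have h1 := (NormedSpace.exp_series_hasSum_exp' (𝕂 := ℝ) ((t / ε) • K)).mapL
    (ℓ.comp (ContinuousLinearMap.apply ℝ E f))
  have h2 := (NormedSpace.exp_series_hasSum_exp' (𝕂 := ℝ) ((t / ε) * r)).mul_left c
  have h3 : ℓ (NormedSpace.exp ((t / ε) • K) f) ≤ c * Real.exp (t / ε * r) := by
    rw [Real.exp_eq_exp_ℝ]
    refine hasSum_le (fun m => ?_) h1 h2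
    change ℓ (((m.factorial : ℝ)⁻¹ • ((t / ε) • K) ^ m) f) ≤ _
    rw [smul_pow, smul_apply, smul_apply, map_smul,
      map_smul, hiter, smul_eq_mul, smul_eq_mul, smul_eq_mul, mul_pow]
    have h4 := mul_le_mul_of_nonneg_left (hpow m)
      (show 0 ≤ (m.factorial : ℝ)⁻¹ * (t / ε) ^ m by positivity)
    calc _ = (m.factorial : ℝ)⁻¹ * (t / ε) ^ m * ℓ ((fun f => f + ε • L f)^[m] f) := by ring
      _ ≤ _ := h4
      _ = _ := by ring
  rw [hexp, smul_apply, map_smul, smul_eq_mul]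
  refine (mul_le_mul_of_nonneg_left h3 (Real.exp_pos _).le).trans_eq ?_
  rw [mul_left_comm, ← Real.exp_add]
  congr 2
  ring

end Semigroup

/-! ### The semigroup and its contraction property -/

/-- The generator acts as a bounded operator on the bounded functions. -/
theorem exists_generatorCLM (hA : BoundedRates Q p₀) (hQ : ∀ i j, i ≠ j → 0 ≤ Q i j)
    (hp₀ : ∀ i, 0 ≤ p₀ i) (hN : 1 ≤ N) :
    ∃ L : (Config S N →ᵇ ℝ) →L[ℝ] (Config S N →ᵇ ℝ), ∀ f η, L f η = generator Q p₀ N f η := by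
  have hf : ∀ (f : Config S N →ᵇ ℝ) η, |f η| ≤ ‖f‖ := fun f η => f.norm_coe_le_norm η
  have hd : ∀ (f : Config S N →ᵇ ℝ) η η', |f η - f η'| ≤ ‖f‖ + ‖f‖ := fun f η η' =>
    (abs_sub _ _).trans (add_le_add (hf f _) (hf f _))
  have hb : ∀ (f : Config S N →ᵇ ℝ) η,
      ‖generator Q p₀ N f η‖ ≤ rateBound Q p₀ N * (‖f‖ + ‖f‖) := by
    intro f η
    rw [generator_eq_jumpSum hA hQ (hf f)]
    exact abs_jumpSum_le hA hQ hp₀ hN η fun k j => hd f _ _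
  refine ⟨LinearMap.mkContinuous
    { toFun := fun f => BoundedContinuousFunction.ofNormedAddCommGroupDiscrete
        (generator Q p₀ N f) _ (hb f)
      map_add' := fun f g => ?_
      map_smul' := fun a f => ?_ } (rateBound Q p₀ N * 2) fun f => ?_, fun f η => rfl⟩
  · ext η
    change generator Q p₀ N (f + g : Config S N →ᵇ ℝ) η =
      generator Q p₀ N f η + generator Q p₀ N g η
    rw [generator_eq_jumpSum hA hQ (hf f), generator_eq_jumpSum hA hQ (hf g),
      generator_eq_jumpSum hA hQ (hf (f + g)),
      ← jumpSum_add hA hQ η (fun k j => hd f _ _) (fun k j => hd g _ _)]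
    congr 1
    ext k j
    simp only [BoundedContinuousFunction.coe_add, Pi.add_apply]
    ring
  · ext η
    change generator Q p₀ N (a • f : Config S N →ᵇ ℝ) η = a * generator Q p₀ N f η
    rw [generator_eq_jumpSum hA hQ (hf f), generator_eq_jumpSum hA hQ (hf (a • f)),
      ← jumpSum_const_mul]
    congr 1
    ext k j
    simp only [BoundedContinuousFunction.coe_smul, smul_eq_mul]
    ring
  · refine (BoundedContinuousFunction.norm_ofNormedAddCommGroup_le _
      (mul_nonneg (rateBound_nonneg hQ hp₀ hN) (by positivity)) (hb f)).trans_eq ?_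
    ring

/-- The bound on the carré du champ `L (f g) - f L g - g L f`. -/
theorem abs_carreDuChamp_le (hA : BoundedRates Q p₀) (hQ : ∀ i j, i ≠ j → 0 ≤ Q i j)
    (hp₀ : ∀ i, 0 ≤ p₀ i) {L : (Config S (n + 1) →ᵇ ℝ) →L[ℝ] (Config S (n + 1) →ᵇ ℝ)}
    (hL : ∀ f η, L f η = generator Q p₀ (n + 1) f η) {f g : Config S (n + 1) →ᵇ ℝ} {c c' : ℝ}
    (hf : DisplacementLipschitz f c) (hg : DisplacementLipschitz g c') (η : Config S (n + 1)) :
    |L (f * g) η - f η * L g η - g η * L f η| ≤ rateBound Q p₀ (n + 1) * (c * c') := by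
  have hb : ∀ (f : Config S (n + 1) →ᵇ ℝ) η, |f η| ≤ ‖f‖ := fun f η => f.norm_coe_le_norm η
  have hprod : ∀ k j, |(f (η.move k j) - f η) * (g (η.move k j) - g η)| ≤ c * c' := by
    intro k j
    rw [abs_mul]
    exact mul_le_mul (hf.abs_move_sub_le η k j) (hg.abs_move_sub_le η k j) (abs_nonneg _)
      ((abs_nonneg _).trans (hf.abs_move_sub_le η k j))
  have hmul : ∀ (a : ℝ) {F : Config S (n + 1) → ℝ} {e : ℝ}, DisplacementLipschitz F e →
      ∀ k j, |a * (F (η.move k j) - F η)| ≤ |a| * e := by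
    intro a F e hF k j
    rw [abs_mul]
    exact mul_le_mul_of_nonneg_left (hF.abs_move_sub_le η k j) (abs_nonneg _)
  have key : L (f * g) η = jumpSum Q p₀ η
      (fun k j => (f (η.move k j) - f η) * (g (η.move k j) - g η)) +
        (f η * L g η + g η * L f η) := by
    rw [hL, hL, hL, generator_eq_jumpSum hA hQ (hb f), generator_eq_jumpSum hA hQ (hb g),
      generator_eq_jumpSum hA hQ (hb (f * g)), ← jumpSum_const_mul, ← jumpSum_const_mul,
      ← jumpSum_add hA hQ η (hmul (f η) hg) (hmul (g η) hf),
      ← jumpSum_add hA hQ η hprod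
        (fun k j => (abs_add_le _ _).trans (add_le_add (hmul (f η) hg k j) (hmul (g η) hf k j)))]
    congr 1
    ext k j
    simp only [BoundedContinuousFunction.coe_mul, Pi.mul_apply]
    ring
  rw [key]
  convert abs_jumpSum_le hA hQ hp₀ (Nat.le_add_left 1 n) η hprod using 2
  ring

/-- If `1 + ε L` contracts the Lipschitz constants by the factor `r`, then the semigroup contracts
them at rate `(1 - r) / ε`. -/
theorem displacementLipschitz_semigroup_of_step
    {L : (Config S (n + 1) →ᵇ ℝ) →L[ℝ] (Config S (n + 1) →ᵇ ℝ)} {ε r : ℝ} (hε : 0 < ε)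
    (hstep : ∀ (f : Config S (n + 1) →ᵇ ℝ) (c : ℝ), DisplacementLipschitz f c →
      DisplacementLipschitz (f + ε • L f) (c * r))
    {f : Config S (n + 1) →ᵇ ℝ} {c : ℝ} (hf : DisplacementLipschitz f c) {t : ℝ} (ht : 0 ≤ t) :
    DisplacementLipschitz (semigroup L t f) (c * Real.exp (-(t * (1 - r) / ε))) := by
  have hpow : ∀ m : ℕ, DisplacementLipschitz ((fun f => f + ε • L f)^[m] f) (c * r ^ m) := by
    intro m
    induction m with
    | zero => simpa using hf
    | succ m ih =>
      rw [Function.iterate_succ_apply', pow_succ, ← mul_assoc]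
      exact hstep _ _ ih
  intro ξ i j
  exact apply_semigroup_le_of_step L (BoundedContinuousFunction.evalCLM ℝ (ξ.insert i) -
    BoundedContinuousFunction.evalCLM ℝ (ξ.insert j)) hε (fun m => hpow m ξ i j) ht

/-- The semigroup contracts the Lipschitz constants at rate `rho`. -/
theorem displacementLipschitz_semigroup (hA : BoundedRates Q p₀) (hQ : ∀ i j, i ≠ j → 0 ≤ Q i j)
    (hp₀ : ∀ i, 0 ≤ p₀ i) (hn : n ≠ 0)
    {L : (Config S (n + 1) →ᵇ ℝ) →L[ℝ] (Config S (n + 1) →ᵇ ℝ)}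
    (hL : ∀ f η, L f η = generator Q p₀ (n + 1) f η) {f : Config S (n + 1) →ᵇ ℝ} {c : ℝ}
    (hf : DisplacementLipschitz f c) {t : ℝ} (ht : 0 ≤ t) :
    DisplacementLipschitz (semigroup L t f) (c * Real.exp (-(rho Q p₀ * t))) := by
  set M := (n + 2) * ((⨆ i, exitRate Q i) + ⨆ i, p₀ i) with hM
  have hM0 : 0 ≤ M := by
    have h1 : 0 ≤ ⨆ i, exitRate Q i :=
      Real.iSup_nonneg fun i => tsum_nonneg fun j => hQ _ _ j.2.symm
    have h2 : 0 ≤ ⨆ i, p₀ i := Real.iSup_nonneg hp₀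
    positivity
  have hpos : 0 < M + |rho Q p₀| + 1 := by positivity
  -- a time step so small that `ε M ≤ 1` and `0 ≤ 1 - ε ρ`
  set ε := 1 / (M + |rho Q p₀| + 1) with hεdef
  have hε : 0 < ε := by positivity
  have hεM : ε * M ≤ 1 := by
    rw [hεdef, one_div_mul_eq_div, div_le_one hpos]
    linarith [abs_nonneg (rho Q p₀)]
  have hερ : ε * rho Q p₀ ≤ 1 := by
    rw [hεdef, one_div_mul_eq_div, div_le_one hpos]
    linarith [le_abs_self (rho Q p₀)]
  convert displacementLipschitz_semigroup_of_step hε (r := 1 - ε * rho Q p₀)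
    (fun f c hf ξ i i' => ?_) hf ht using 4
  · field_simp
    ring
  · have hc : 0 ≤ c := by simpa using hf ξ i i
    by_cases hi : i = i'
    · subst hi
      rw [sub_self]
      exact mul_nonneg hc (by linarith)
    · have h := generator_insert_sub_le hA hQ hp₀ hn (fun η => f.norm_coe_le_norm η) hf ξ hi
      rw [← hM] at h
      have h1 := mul_le_mul_of_nonneg_left h hε.le
      have h2 := mul_le_mul_of_nonneg_right hεM (sub_nonneg.2 (hf ξ i i'))
      simp only [Pi.add_apply, BoundedContinuousFunction.coe_add,
        BoundedContinuousFunction.coe_smul, smul_eq_mul, hL]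
      linarith

/-! ### The covariance under the semigroup -/

theorem hasDerivAt_decayFactor (ρ t s : ℝ) :
    HasDerivAt (fun s => decayFactor ρ t - decayFactor ρ (t - s))
      (Real.exp (-(ρ * (t - s))) * Real.exp (-(ρ * (t - s)))) s := by
  rw [← Real.exp_add]
  by_cases h : ρ = 0
  · simp only [decayFactor, h]
    simpa using (hasDerivAt_id s).const_sub t |>.const_sub t
  · simp only [decayFactor, if_neg h]
    have h1 : HasDerivAt (fun s => -2 * ρ * (t - s)) (-2 * ρ * (-1)) s :=
      ((hasDerivAt_id s).const_sub t).const_mul _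
    have h2 := ((h1.exp.const_sub 1).div_const (2 * ρ)).const_sub
      ((1 - Real.exp (-2 * ρ * t)) / (2 * ρ))
    convert! h2 using 1
    rw [show -(ρ * (t - s)) + -(ρ * (t - s)) = -2 * ρ * (t - s) by ring]
    field_simp

theorem decayFactor_zero (ρ : ℝ) : decayFactor ρ 0 = 0 := by simp [decayFactor]

/-- The covariance bound for the semigroup, if `f ↦ P_s f (x)` is a contraction for the supremum
norm: `s ↦ P_s (P_{t-s} g * P_{t-s} h)` interpolates between
`P_t g * P_t h` and `P_t (g * h)`, and its derivative is `P_s` applied to the carré du champ of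
`P_{t-s} g` and `P_{t-s} h`. -/
theorem abs_semigroup_mul_sub_le (hA : BoundedRates Q p₀) (hQ : ∀ i j, i ≠ j → 0 ≤ Q i j)
    (hp₀ : ∀ i, 0 ≤ p₀ i) (hn : n ≠ 0)
    {L : (Config S (n + 1) →ᵇ ℝ) →L[ℝ] (Config S (n + 1) →ᵇ ℝ)}
    (hL : ∀ f η, L f η = generator Q p₀ (n + 1) f η) (x : Config S (n + 1))
    {t : ℝ} (ht : 0 ≤ t)
    (hP : ∀ s ∈ Set.Icc 0 t, ∀ F : Config S (n + 1) →ᵇ ℝ, ∀ C, (∀ η, |F η| ≤ C) →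
      |semigroup L s F x| ≤ C)
    {g h : Config S (n + 1) →ᵇ ℝ}
    (hg : DisplacementLipschitz g 1) (hh : DisplacementLipschitz h 1) :
    |semigroup L t (g * h) x -
        semigroup L t g x * semigroup L t h x| ≤
      decayFactor (rho Q p₀) t * rateBound Q p₀ (n + 1) := by
  set U : ℝ → (Config S (n + 1) →ᵇ ℝ) →L[ℝ] (Config S (n + 1) →ᵇ ℝ) :=
    fun s => semigroup L s with hU
  have hUd : ∀ (f : Config S (n + 1) →ᵇ ℝ) s,
      HasDerivAt (fun s => U (t - s) f) (-(L (U (t - s) f))) s := by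
    intro f s
    have h2 : HasDerivAt (fun s => t - s) (-1) s := by
      simpa using (hasDerivAt_id s).const_sub t
    simpa [Function.comp_def] using (hasDerivAt_semigroup L f (t - s)).scomp s h2
  have hder : ∀ s, HasDerivAt (fun s => U s (U (t - s) g * U (t - s) h) x)
      (U s (L (U (t - s) g * U (t - s) h) - U (t - s) g * L (U (t - s) h) -
        U (t - s) h * L (U (t - s) g)) x) s := by
    intro s
    have h2 := HasDerivAt.semigroup_apply L ((hUd g s).mul (hUd h s))
    have h3 := (BoundedContinuousFunction.evalCLM ℝ x).hasFDerivAt.comp_hasDerivAt s h2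
    convert! h3 using 1
    change _ = U s _ x
    congr 2
    change _ = L (U (t - s) g * U (t - s) h) + _
    ring
  have hbound : ∀ s ∈ Set.Ico 0 t, ‖U s (L (U (t - s) g * U (t - s) h) -
      U (t - s) g * L (U (t - s) h) - U (t - s) h * L (U (t - s) g)) x‖ ≤
      Real.exp (-(rho Q p₀ * (t - s))) * Real.exp (-(rho Q p₀ * (t - s))) *
        rateBound Q p₀ (n + 1) := by
    intro s hs
    refine hP s ⟨hs.1, hs.2.le⟩ _ _ fun η => ?_
    have h1 := displacementLipschitz_semigroup hA hQ hp₀ hn hL hg (sub_nonneg.2 hs.2.le)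
    have h2 := displacementLipschitz_semigroup hA hQ hp₀ hn hL hh (sub_nonneg.2 hs.2.le)
    rw [one_mul] at h1 h2
    rw [mul_comm _ (rateBound _ _ _)]
    exact abs_carreDuChamp_le hA hQ hp₀ hL h1 h2 η
  have hB : ∀ s, HasDerivAt (fun s => (decayFactor (rho Q p₀) t - decayFactor (rho Q p₀) (t - s)) *
      rateBound Q p₀ (n + 1)) (Real.exp (-(rho Q p₀ * (t - s))) *
        Real.exp (-(rho Q p₀ * (t - s))) * rateBound Q p₀ (n + 1)) s := fun s =>
    (hasDerivAt_decayFactor (rho Q p₀) t s).mul_const _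
  have hfinal := image_norm_le_of_norm_deriv_right_le_deriv_boundary
    (f := fun s => U s (U (t - s) g * U (t - s) h) x - U 0 (U t g * U t h) x)
    (a := 0) (b := t)
    (fun s _ => ((hder s).sub_const _).continuousAt.continuousWithinAt)
    (fun s _ => ((hder s).sub_const _).hasDerivWithinAt) (by simp) hB hbound
    (Set.right_mem_Icc.2 ht)
  simpa [hU, decayFactor_zero, semigroup_zero] using hfinal

/-! ### One-dimensional distributions of the process -/

/-- A right-continuous process with measurable marginals is jointly measurable: it is the limit of
its values at the next grid points `(⌊m s⌋ + 1) / m`. -/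
theorem measurable_uncurry_of_rightContinuous {Ω X : Type*} [MeasurableSpace Ω]
    [TopologicalSpace X] {Y : ℝ≥0 → Ω → X} {f : X → ℝ} (hf : Continuous f)
    (hmeas : ∀ t, Measurable fun ω => f (Y t ω))
    (hY : ∀ ω t, ContinuousWithinAt (fun s => Y s ω) (Set.Ici t) t) :
    Measurable fun q : ℝ≥0 × Ω => f (Y q.1 q.2) := by
  set u : ℕ → ℝ≥0 → ℝ≥0 := fun m s => ((⌊((m : ℝ≥0) + 1) * s⌋₊ : ℝ≥0) + 1) / ((m : ℝ≥0) + 1)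
    with hu
  have hm : ∀ m : ℕ, (0 : ℝ≥0) < (m : ℝ≥0) + 1 := fun m => by positivity
  have hlow : ∀ m s, s ≤ u m s := fun m s => by
    rw [hu, le_div_iff₀ (hm m), mul_comm]
    exact (Nat.lt_floor_add_one _).le
  have hupp : ∀ m s, u m s ≤ s + 1 / ((m : ℝ≥0) + 1) := fun m s => by
    rw [hu, div_le_iff₀ (hm m), add_mul s, one_div_mul_cancel (hm m).ne', mul_comm s]
    gcongr
    exact Nat.floor_le zero_le
  have htend : ∀ s, Tendsto (fun m => u m s) atTop (𝓝 s) := fun s => by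
    refine tendsto_of_tendsto_of_tendsto_of_le_of_le tendsto_const_nhds ?_
      (fun m => hlow m s) (fun m => hupp m s)
    simpa using (tendsto_one_div_add_atTop_nhds_zero_nat (𝕜 := ℝ≥0)).const_add s
  refine measurable_of_tendsto_metrizable
    (f := fun m (q : ℝ≥0 × Ω) => f (Y (u m q.1) q.2)) (fun m => ?_) ?_
  · have h1 : ∀ Z : ℕ → Ω → ℝ, (∀ k, Measurable (Z k)) →
        Measurable fun q : ℕ × Ω => Z q.1 q.2 := fun Z hZ =>
      measurable_from_prod_countable_right hZ
    have h2 : Measurable fun s : ℝ≥0 => ⌊((m : ℝ≥0) + 1) * s⌋₊ :=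
      Nat.measurable_floor.comp (measurable_const_mul _)
    have h3 := (h1 (fun k ω => f (Y (((k : ℝ≥0) + 1) / ((m : ℝ≥0) + 1)) ω))
      fun k => hmeas _).comp ((h2.comp measurable_fst).prodMk measurable_snd)
    exact h3
  · rw [tendsto_pi_nhds]
    rintro ⟨s, ω⟩
    have h1 : Tendsto (fun m => u m s) atTop (𝓝[Set.Ici s] s) :=
      tendsto_nhdsWithin_iff.2 ⟨htend s, Eventually.of_forall fun m => hlow m s⟩
    exact (hf.tendsto _).comp ((hY ω s).tendsto.comp h1)

section Trajectories

variable {Ω : Type*} {mΩ : MeasurableSpace Ω} {P : Measure Ω} {ℱ : Filtration ℝ≥0 mΩ}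
  {X : ℝ≥0 → Ω → Config S N} {x : Config S N}

theorem IsFlemingViot.measurable_comp (hX : IsFlemingViot Q p₀ N x P ℱ X)
    (f : Config S N → ℝ) (t : ℝ≥0) : Measurable fun ω => f (X t ω) :=
  measurable_from_top.comp ((hX.adapted t).mono (ℱ.le t) le_rfl)

theorem IsFlemingViot.measurable_uncurry (hX : IsFlemingViot Q p₀ N x P ℱ X)
    (f : Config S N → ℝ) : Measurable fun q : ℝ × Ω => f (X q.1.toNNReal q.2) :=
  (measurable_uncurry_of_rightContinuous continuous_of_discreteTopology
    (hX.measurable_comp f) hX.rightContinuous).comp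
    ((measurable_real_toNNReal.comp measurable_fst).prodMk measurable_snd)

/-- Dynkin's formula. -/
theorem IsFlemingViot.integral_eq [IsProbabilityMeasure P] (hX : IsFlemingViot Q p₀ N x P ℱ X)
    {L : (Config S N →ᵇ ℝ) →L[ℝ] (Config S N →ᵇ ℝ)}
    (hL : ∀ f η, L f η = generator Q p₀ N f η) (f : Config S N →ᵇ ℝ) (t : ℝ≥0) :
    IntervalIntegrable (fun s => ∫ ω, L f (X s.toNNReal ω) ∂P) volume 0 t ∧
    ∫ ω, f (X t ω) ∂P = f x + ∫ s in (0 : ℝ)..t, ∫ ω, L f (X s.toNNReal ω) ∂P := by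
  have hM := hX.martingale f ⟨‖f‖, fun η => f.norm_coe_le_norm η⟩
  simp only [← hL] at hM
  have hint : ∀ (F : Config S N →ᵇ ℝ) s, Integrable (fun ω => F (X s ω)) P := fun F s =>
    Integrable.of_bound (hX.measurable_comp F s).aestronglyMeasurable ‖F‖
      (Eventually.of_forall fun ω => F.norm_coe_le_norm _)
  have hprod : Integrable (Function.uncurry fun (s : ℝ) ω => L f (X s.toNNReal ω))
      ((volume.restrict (Set.Ioc 0 (t : ℝ))).prod P) :=
    Integrable.of_bound (hX.measurable_uncurry (L f)).aestronglyMeasurable ‖L f‖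
      (Eventually.of_forall fun q => (L f).norm_coe_le_norm _)
  have hI : IntervalIntegrable (fun s => ∫ ω, L f (X s.toNNReal ω) ∂P) volume 0 t := by
    rw [intervalIntegrable_iff_integrableOn_Ioc_of_le t.coe_nonneg]
    exact hprod.integral_prod_left
  refine ⟨hI, ?_⟩
  have h0 : ∫ ω, (f (X t ω) - ∫ s in (0 : ℝ)..t, L f (X s.toNNReal ω)) ∂P =
      ∫ ω, (f (X 0 ω) - ∫ s in (0 : ℝ)..(0 : ℝ≥0), L f (X s.toNNReal ω)) ∂P := by
    have := hM.setIntegral_eq (zero_le (a := t)) MeasurableSet.univ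
    simpa only [setIntegral_univ] using this.symm
  have h1 : ∫ ω, (f (X 0 ω) - ∫ s in (0 : ℝ)..(0 : ℝ≥0), L f (X s.toNNReal ω)) ∂P = f x := by
    rw [integral_congr_ae (g := fun _ => f x)]
    · simp
    · filter_upwards [hX.initial] with ω hω
      simp [hω]
  have hIint : Integrable (fun ω => ∫ s in (0 : ℝ)..t, L f (X s.toNNReal ω)) P := by
    simp only [intervalIntegral.integral_of_le t.coe_nonneg]
    exact hprod.integral_prod_right
  rw [h1, integral_sub (hint f t) hIint] at h0
  have hswap : ∫ ω, (∫ s in (0 : ℝ)..t, L f (X s.toNNReal ω)) ∂P =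
      ∫ s in (0 : ℝ)..t, ∫ ω, L f (X s.toNNReal ω) ∂P := by
    simp only [intervalIntegral.integral_of_le t.coe_nonneg]
    exact (integral_integral_swap hprod).symm
  rw [← hswap]
  linarith

/-- The martingale problem determines the one-dimensional distributions: by Dynkin's formula, the
difference `D t f` between `E f(X_t)` and the semigroup satisfies `D t f = ∫₀ᵗ D s (L f) ds`, and
iterating this gives `|D t f| ≤ C ‖L‖ ^ m t ^ m / m! ‖f‖` for all `m`. -/
theorem IsFlemingViot.integral_eq_semigroup [IsProbabilityMeasure P]
    (hX : IsFlemingViot Q p₀ N x P ℱ X)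
    {L : (Config S N →ᵇ ℝ) →L[ℝ] (Config S N →ᵇ ℝ)}
    (hL : ∀ f η, L f η = generator Q p₀ N f η) (f : Config S N →ᵇ ℝ) (t : ℝ≥0) :
    ∫ ω, f (X t ω) ∂P = semigroup L t f x := by
  set D : ℝ → (Config S N →ᵇ ℝ) → ℝ := fun s F =>
    ∫ ω, F (X s.toNNReal ω) ∂P - semigroup L s F x with hD
  set T : ℝ := (t : ℝ) with hT
  have hT0 : 0 ≤ T := t.coe_nonneg
  have hder : ∀ (F : Config S N →ᵇ ℝ) s,
      HasDerivAt (fun s => semigroup L s F x) (semigroup L s (L F) x) s := fun F s => by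
    have h := HasDerivAt.semigroup_apply L (hasDerivAt_const s F)
    rw [add_zero] at h
    exact (BoundedContinuousFunction.evalCLM ℝ x).hasFDerivAt.comp_hasDerivAt s h
  have hcont : ∀ F : Config S N →ᵇ ℝ, Continuous fun s => semigroup L s F x := fun F =>
    continuous_iff_continuousAt.2 fun s => (hder F s).continuousAt
  have hrec : ∀ F, ∀ s : ℝ, 0 ≤ s → D s F = ∫ r in (0 : ℝ)..s, D r (L F) := by
    intro F s hs
    lift s to ℝ≥0 using hs
    obtain ⟨h1, h2⟩ := hX.integral_eq hL F s
    have h3 := intervalIntegral.integral_eq_sub_of_hasDerivAt (a := 0) (b := (s : ℝ))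
      (fun r _ => hder F r) ((hcont (L F)).intervalIntegrable _ _)
    simp only [hD, Real.toNNReal_coe]
    rw [intervalIntegral.integral_sub h1 ((hcont (L F)).intervalIntegrable _ _), h2, h3,
      semigroup_zero]
    ring
  -- a bound for `D` that is uniform on `[0, T]`
  obtain ⟨C, hC⟩ : ∃ C, ∀ s ∈ Set.Icc 0 T, ‖semigroup L s‖ ≤ C := by
    have hc : Continuous fun s : ℝ => semigroup L s :=
      continuous_iff_continuousAt.2 fun s =>
        (hasDerivAt_exp_smul_const (𝕂 := ℝ) L s).continuousAt
    obtain ⟨C, hC⟩ := (isCompact_Icc.image hc).isBounded.exists_norm_le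
    exact ⟨C, fun s hs => hC _ ⟨s, hs, rfl⟩⟩
  have hbound : ∀ m : ℕ, ∀ F, ∀ s ∈ Set.Icc 0 T,
      |D s F| ≤ (1 + C) * ‖F‖ * (‖L‖ ^ m * s ^ m / m.factorial) := by
    intro m
    induction m with
    | zero =>
      intro F s hs
      have h1 : |∫ ω, F (X s.toNNReal ω) ∂P| ≤ ‖F‖ := by
        simpa using norm_integral_le_of_norm_le_const (μ := P)
          (Eventually.of_forall fun ω => F.norm_coe_le_norm (X s.toNNReal ω))
      have h2 : |semigroup L s F x| ≤ C * ‖F‖ :=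
        ((semigroup L s F).norm_coe_le_norm x).trans ((semigroup L s).le_of_opNorm_le (hC s hs) F)
      refine (abs_sub _ _).trans ((add_le_add h1 h2).trans_eq ?_)
      simp
      ring
    | succ m ih =>
      intro F s hs
      have hC0 : 0 ≤ 1 + C := by
        linarith [(norm_nonneg _).trans (hC 0 ⟨le_rfl, hT0⟩)]
      rw [hrec F s hs.1]
      have h1 : ∀ r ∈ Set.Ioc 0 s, ‖D r (L F)‖ ≤
          (1 + C) * (‖L‖ * ‖F‖) * (‖L‖ ^ m / m.factorial) * r ^ m := by
        intro r hr
        refine (ih (L F) r ⟨hr.1.le, hr.2.trans hs.2⟩).trans ?_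
        have := hr.1.le
        calc _ ≤ (1 + C) * (‖L‖ * ‖F‖) * (‖L‖ ^ m * r ^ m / m.factorial) := by
              gcongr
              exact L.le_opNorm F
          _ = _ := by ring
      refine (intervalIntegral.norm_integral_le_of_norm_le hs.1
        (Eventually.of_forall h1) (Continuous.intervalIntegrable (by fun_prop) _ _)).trans_eq ?_
      rw [intervalIntegral.integral_const_mul, integral_pow, Nat.factorial_succ]
      push_cast
      have : (m.factorial : ℝ) ≠ 0 := by positivity
      field_simp
      ring
  have hlim : Tendsto (fun m : ℕ => (1 + C) * ‖f‖ * (‖L‖ ^ m * T ^ m / m.factorial)) atTop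
      (𝓝 0) := by
    simpa [mul_pow] using
      (FloorSemiring.tendsto_pow_div_factorial_atTop (‖L‖ * T)).const_mul ((1 + C) * ‖f‖)
  have hzero : |D T f| ≤ 0 :=
    ge_of_tendsto' hlim fun m => hbound m f T ⟨hT0, le_rfl⟩
  have := abs_nonpos_iff.1 hzero
  simpa [hD, hT, sub_eq_zero] using this

theorem IsFlemingViot.abs_semigroup_le [IsProbabilityMeasure P]
    (hX : IsFlemingViot Q p₀ N x P ℱ X)
    {L : (Config S N →ᵇ ℝ) →L[ℝ] (Config S N →ᵇ ℝ)}
    (hL : ∀ f η, L f η = generator Q p₀ N f η) {s : ℝ} (hs : 0 ≤ s) (f : Config S N →ᵇ ℝ)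
    {C : ℝ} (hf : ∀ η, |f η| ≤ C) : |semigroup L s f x| ≤ C := by
  lift s to ℝ≥0 using hs
  rw [← hX.integral_eq_semigroup hL]
  simpa using norm_integral_le_of_norm_le_const (μ := P)
    (f := fun ω => f (X s ω)) (Eventually.of_forall fun ω => hf (X s ω))

end Trajectories

/-! ### Lipschitz functions of the configuration are bounded -/

theorem d₁_le (η η' : Config S N) : d₁ η η' ≤ N := by
  have h : ∀ η : Config S N, HasSum (fun j => (η j : ℝ)) N := fun η => by
    have h1 := η.particleSum_const 1
    rw [mul_one] at h1
    rw [← h1, Config.particleSum]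
    simp only [mul_one]
    exact hasSum_sum_of_ne_finset_zero fun j hj => by
      simp [Finsupp.notMem_support_iff.1 hj]
  have hle : ∀ j, |(η j : ℝ) - (η' j : ℝ)| ≤ (η j : ℝ) + (η' j : ℝ) := fun j =>
    (abs_sub _ _).trans_eq (by simp)
  have hs := (h η).add (h η')
  have h2 := (Summable.of_nonneg_of_le (fun _ => abs_nonneg _) hle hs.summable).tsum_le_tsum hle
    hs.summable
  rw [hs.tsum_eq] at h2
  rw [d₁]
  linarith

theorem exists_boundedContinuousFunction_of_d₁ {f : Config S N → ℝ}
    (hf : ∀ η η', |f η - f η'| ≤ d₁ η η') (x : Config S N) :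
    ∃ F : Config S N →ᵇ ℝ, ∀ η, F η = f η := by
  refine ⟨BoundedContinuousFunction.ofNormedAddCommGroupDiscrete f (N + |f x|) fun η => ?_,
    fun η => rfl⟩
  have h1 := (hf η x).trans (d₁_le η x)
  have h2 := abs_add_le (f η - f x) (f x)
  rw [sub_add_cancel] at h2
  rw [Real.norm_eq_abs]
  linarith

end FlemingViot

theorem mainTheorem2 {S : Type*} [Countable S] (Q : S → S → ℝ) (p₀ : S → ℝ)
    (hQ : ∀ i j, i ≠ j → 0 ≤ Q i j) (hp₀ : ∀ i, 0 ≤ p₀ i)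
    (hA : FlemingViot.BoundedRates Q p₀)
    (N : ℕ) (hN : 2 ≤ N)
    (g h : FlemingViot.Config S N → ℝ)
    (hg : ∀ η η', |g η - g η'| ≤ FlemingViot.d₁ η η')
    (hh : ∀ η η', |h η - h η'| ≤ FlemingViot.d₁ η η')
    (η : FlemingViot.Config S N)
    {Ω : Type*} {mΩ : MeasurableSpace Ω} (P : Measure Ω) [IsProbabilityMeasure P]
    (ℱ : Filtration ℝ≥0 mΩ) (X : ℝ≥0 → Ω → FlemingViot.Config S N)
    (hX : FlemingViot.IsFlemingViot Q p₀ N η P ℱ X) :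
    (∀ t : ℝ≥0,
      |covariance (fun ω => g (X t ω)) (fun ω => h (X t ω)) P| ≤
        FlemingViot.decayFactor (FlemingViot.rho Q p₀) t * FlemingViot.rateBound Q p₀ N) ∧
    (0 < FlemingViot.rho Q p₀ → ∀ t : ℝ≥0,
      |covariance (fun ω => g (X t ω)) (fun ω => h (X t ω)) P| ≤
        1 / (2 * FlemingViot.rho Q p₀) * FlemingViot.rateBound Q p₀ N) := by
  have hbound : ∀ t : ℝ≥0,
      |covariance (fun ω => g (X t ω)) (fun ω => h (X t ω)) P| ≤
        FlemingViot.decayFactor (FlemingViot.rho Q p₀) t * FlemingViot.rateBound Q p₀ N := by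
    intro t
    obtain ⟨n, rfl⟩ : ∃ n, N = n + 1 := ⟨N - 1, by omega⟩
    obtain ⟨L, hL⟩ := FlemingViot.exists_generatorCLM hA hQ hp₀ (Nat.le_add_left 1 n)
    obtain ⟨G, hG⟩ := FlemingViot.exists_boundedContinuousFunction_of_d₁ hg η
    obtain ⟨H, hH⟩ := FlemingViot.exists_boundedContinuousFunction_of_d₁ hh η
    obtain rfl : ⇑G = g := funext hG
    obtain rfl : ⇑H = h := funext hH
    have hmem : ∀ F : BoundedContinuousFunction (FlemingViot.Config S (n + 1)) ℝ,
        MemLp (fun ω => F (X t ω)) 2 P := fun F =>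
      MemLp.of_bound (hX.measurable_comp F t).aestronglyMeasurable ‖F‖
        (Eventually.of_forall fun ω => F.norm_coe_le_norm _)
    have hmul := hX.integral_eq_semigroup hL (G * H) t
    rw [covariance_eq_sub (hmem G) (hmem H), hX.integral_eq_semigroup hL G t,
      hX.integral_eq_semigroup hL H t]
    simp only [BoundedContinuousFunction.coe_mul, Pi.mul_apply] at hmul
    simp only [Pi.mul_apply, hmul]
    exact FlemingViot.abs_semigroup_mul_sub_le hA hQ hp₀ (by omega) hL η t.coe_nonneg
      (fun s hs F C hF => hX.abs_semigroup_le hL hs.1 F hF)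
      (FlemingViot.displacementLipschitz_of_d₁ hg) (FlemingViot.displacementLipschitz_of_d₁ hh)
  refine ⟨hbound, fun hρ t => (hbound t).trans ?_⟩
  refine mul_le_mul_of_nonneg_right ?_
    (FlemingViot.rateBound_nonneg hQ hp₀ (one_le_two.trans hN))
  rw [FlemingViot.decayFactor, if_neg hρ.ne']
  refine div_le_div_of_nonneg_right ?_ (by positivity)
  linarith [Real.exp_pos (-2 * FlemingViot.rho Q p₀ * t)]
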